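/- Throughout, smooth means $C^\infty$, $\mathbb{S}^{n-1}$ is the unit sphere of $\mathbb{R}^n$, and sub-manifolds are embedded, without boundary unless stated otherwise, and may have components of different dimensions. Let $M=[0,\infty)\times\mathbb{S}^{n-1}$, a smooth manifold with boundary $\partial M=\{0\}\times\mathbb{S}^{n-1}$. A p-sub-manifold of an open subset $U$ of $M$ is a subset $N\subset U$ that is a smooth sub-manifold with boundary, such that $\partial N=N\cap\partial M$ and $T_pN+T_p\partial M=T_pM$ for every $p\in\partial N$. Let $X\subset\mathbb{R}^n$. A point $a \in X$ is a singular point of $X$ if $X$ is not a smooth sub-manifold near $a$; let $X_{\mathrm{sing}}$ be the set of singular points. A point $a\in X$ near which $X$ is closed is a conic point of $X$ if for some $r>0$ the closure in $[0,r)\times\mathbb{S}^{n-1}$ of $$\{(t,u): 0<t<r,\ u\in\mathbb{S}^{n-1},\ a+tu\in X\}$$ is a p-sub-manifold of $[0,r)\times\mathbb{S}^{n-1}$. Let $\overline{X}$ be the closure in $M$ of $\{(t,u): t>0,\ u\in\mathbb{S}^{n-1},\ t^{-1}u\in X\}$, and write $\overline{X}\cap\partial M=\{0\}\times X^\infty$.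 The set $X$ is conic at infinity if either $X$ is bounded, or $X^\infty\neq\emptyset$ and there is an open neighbourhood $W$ of $\{0\}\times X^\infty$ in $M$ such that $\overline{X}\cap W$ is a p-sub-manifold of $W$. The set $X$ is a conic singular sub-manifold of $\mathbb{R}^n$ if it is closed, $X_{\mathrm{sing}}$ is finite (possibly empty), every point of $X_{\mathrm{sing}}$ is a conic point of $X$, and $X$ is conic at infinity. For $x,x'\in X$ let $d_{\mathrm{inn}}^X(x,x')\in[0,\infty]$ be the infimum of the lengths of the rectifiable paths lying in $X$ that join $x$ to $x'$. The set $X$ is Lipschitz normally embedded (LNE) if there is a constant $L>0$ such that $d_{\mathrm{inn}}^X(x,x')\le L\,|x-x'|$ for all $x,x'\in X$. Theorem. Every connected conic singular sub-manifold $X$ of $\mathbb{R}^n$ is LNE. -/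

import Mathlib

open scoped ContDiff ENNReal

namespace ConicLNE

section InnerDistance

variable {E : Type*} [PseudoEMetricSpace E]

/-- The inner distance of `S`: the infimum of the lengths of the paths lying in `S` that join
`x` to `y`. Non-rectifiable paths have length `∞`, so they do not affect the infimum, which is
`∞` when no rectifiable path in `S` joins the two points. -/
noncomputable def innerDist (S : Set E) (x y : E) : ℝ≥0∞ :=
  ⨅ (γ : Path x y) (_ : Set.range γ ⊆ S), eVariationOn γ Set.univ

/-- `S` is Lipschitz normally embedded. -/
def IsLNE (S : Set E) : Prop :=
  ∃ L : NNReal, 0 < L ∧ ∀ x ∈ S, ∀ y ∈ S, innerDist S x y ≤ (L : ℝ≥0∞) * edist x y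

end InnerDistance

section Submanifolds

variable {F : Type*} [NormedAddCommGroup F] [NormedSpace ℝ F]

/-- `Φ` is a smooth diffeomorphism between open subsets of `F`. -/
def IsSmoothDiffeo (Φ : OpenPartialHomeomorph F F) : Prop :=
  ContDiffOn ℝ ∞ Φ Φ.source ∧ ContDiffOn ℝ ∞ Φ.symm Φ.target

/-- The germ of `N` at its point `p` is that of a smooth (embedded, boundaryless) sub-manifold:
some smooth chart of `F` around `p` straightens `N` to a linear subspace. The dimension may depend
on `p`. -/
def IsSmoothPoint (N : Set F) (p : F) : Prop :=
  ∃ (Φ : OpenPartialHomeomorph F F) (V : Submodule ℝ F),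
    IsSmoothDiffeo Φ ∧ p ∈ Φ.source ∧ ∀ x ∈ Φ.source, (x ∈ N ↔ Φ x ∈ V)

/-- The singular locus of `N`. -/
def singularLocus (N : Set F) : Set F := {p ∈ N | ¬ IsSmoothPoint N p}

/-- `Φ` is a smooth chart of `F` around `p` that straightens `N` to the closed half-space
`{v ∈ V | 0 ≤ ℓ v}` of the linear subspace `V`, sending `p` to a point of the boundary hyperplane:
near `p`, the set `N` is a smooth sub-manifold with boundary, and `p` is a boundary point. -/
structure IsBoundaryChart (N : Set F) (p : F) (Φ : OpenPartialHomeomorph F F)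
    (V : Submodule ℝ F) (ℓ : F →L[ℝ] ℝ) : Prop where
  smooth : IsSmoothDiffeo Φ
  mem_source : p ∈ Φ.source
  nondegenerate : ∃ v ∈ V, ℓ v ≠ 0
  boundary : ℓ (Φ p) = 0
  mem_iff : ∀ x ∈ Φ.source, (x ∈ N ↔ Φ x ∈ V ∧ 0 ≤ ℓ (Φ x))

end Submanifolds

section Conic

variable {E : Type*} [NormedAddCommGroup E] [InnerProductSpace ℝ E]

/-- `N` is a p-sub-manifold of (an open subset of) the manifold with boundary
`M = [0, ∞) × 𝕊`, with `𝕊` the unit sphere of `E`: `N` is a smooth sub-manifold with boundary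
whose boundary points are exactly its points in `∂M = {0} × 𝕊`, and at every such point
`p = (0, u)` it is transverse to the boundary, `T_p N + T_p ∂M = T_p M`. Here `T_p N` is the
preimage of `V` under the differential of the straightening chart, `T_p ∂M = 0 × u^⊥` and
`T_p M = ℝ × u^⊥`. -/
def IsPSubmanifold (N : Set (ℝ × E)) : Prop :=
  (∀ p ∈ N, 0 ≤ p.1 ∧ ‖p.2‖ = 1) ∧
  (∀ p ∈ N, 0 < p.1 → IsSmoothPoint N p) ∧
  (∀ p ∈ N, p.1 = 0 →
    ∃ (Φ : OpenPartialHomeomorph (ℝ × E) (ℝ × E)) (V : Submodule ℝ (ℝ × E))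
      (ℓ : (ℝ × E) →L[ℝ] ℝ),
      IsBoundaryChart N p Φ V ℓ ∧
      V.comap (fderiv ℝ Φ p).toLinearMap ⊔ Submodule.prod ⊥ (ℝ ∙ p.2)ᗮ
        = Submodule.prod ⊤ (ℝ ∙ p.2)ᗮ)

/-- The strict transform of `S` by the spherical blowing-up `(t, u) ↦ t u + a` of `E` at `a`:
the closure of the preimage of `S \ {a}`. -/
def strictTransform (S : Set E) (a : E) : Set (ℝ × E) :=
  closure {p : ℝ × E | 0 < p.1 ∧ ‖p.2‖ = 1 ∧ a + p.1 • p.2 ∈ S}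

/-- `a` is a conic point of `X`: the germ of `X` at `a` is non-empty and closed, and for some
`r > 0` the strict transform of `X ∩ B(a, r)`, taken in `[0, r) × 𝕊`, is a p-sub-manifold of
`[0, r) × 𝕊` (being a closure, it is automatically closed there). -/
def IsConicPoint (X : Set E) (a : E) : Prop :=
  a ∈ X ∧ (∃ ε > 0, IsClosed (X ∩ Metric.closedBall a ε)) ∧
    ∃ r > 0, IsPSubmanifold (strictTransform (X ∩ Metric.ball a r) a ∩ {p | p.1 < r})

/-- The closure of `X`, near the sphere at infinity `{0} × 𝕊`, in the compactification of `E`,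
seen in the chart `(t, u) ↦ t⁻¹ u` on `[0, ∞) × 𝕊`. -/
def closureAtInfinity (X : Set E) : Set (ℝ × E) :=
  closure {p : ℝ × E | 0 < p.1 ∧ ‖p.2‖ = 1 ∧ p.1⁻¹ • p.2 ∈ X}

/-- The asymptotic set of `X` at infinity, a subset of the unit sphere. -/
def asymptoticSet (X : Set E) : Set E := {u | ((0 : ℝ), u) ∈ closureAtInfinity X}

/-- `X` is conic at infinity: it is bounded, or its asymptotic set is non-empty and the germ of
the closure of `X` along the asymptotic set is that of a p-sub-manifold. -/
def IsConicAtInfinity (X : Set E) : Prop :=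
  Bornology.IsBounded X ∨
    ((asymptoticSet X).Nonempty ∧
      ∃ W : Set (ℝ × E), IsOpen W ∧ {(0 : ℝ)} ×ˢ asymptoticSet X ⊆ W ∧
        IsPSubmanifold (closureAtInfinity X ∩ W))

/-- Conic singular sub-manifolds of a Euclidean space. -/
structure IsConicSingularSubmanifold (X : Set E) : Prop where
  isClosed : IsClosed X
  finite_singularLocus : (singularLocus X).Finite
  conic_of_singular : ∀ a ∈ singularLocus X, IsConicPoint X a
  conic_at_infinity : IsConicAtInfinity X

end Conic

end ConicLNE

namespace ConicLNE

open Filter Topology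

section InnerDist

variable {E : Type*} [PseudoEMetricSpace E]

lemma innerDist_symm_le (S : Set E) (x y : E) : innerDist S y x ≤ innerDist S x y := by
  refine le_iInf₂ fun γ hγ => ?_
  refine (iInf₂_le γ.symm (by rwa [Path.symm_range])).trans ?_
  have : (γ.symm : unitInterval → E) = γ ∘ unitInterval.symm := rfl
  rw [this]
  exact eVariationOn.comp_le_of_antitoneOn _ _
    (fun a _ b _ h => unitInterval.symm_le_symm.2 h) (fun _ _ => Set.mem_univ _)

lemma innerDist_comm (S : Set E) (x y : E) : innerDist S x y = innerDist S y x :=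
  le_antisymm (innerDist_symm_le S y x) (innerDist_symm_le S x y)

lemma eVariationOn_trans_le {x y z : E} (γ : Path x y) (γ' : Path y z) :
    eVariationOn (γ.trans γ') Set.univ ≤ eVariationOn γ Set.univ + eVariationOn γ' Set.univ := by
  set h : unitInterval := ⟨1 / 2, by norm_num, by norm_num⟩ with hh
  have hu : eVariationOn (γ.trans γ') Set.univ
      = eVariationOn (γ.trans γ') (Set.Iic h) + eVariationOn (γ.trans γ') (Set.Ici h) := by
    rw [← eVariationOn.union _ isGreatest_Iic isLeast_Ici, Set.Iic_union_Ici]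
  rw [hu]
  refine add_le_add ?_ ?_
  · have : Set.EqOn (γ.trans γ') (γ ∘ fun t : unitInterval => Set.projIcc 0 1 zero_le_one (2 * (t : ℝ)))
        (Set.Iic h) := by
      intro t ht
      have ht' : (t : ℝ) ≤ 1 / 2 := ht
      simp only [Path.trans, Path.coe_mk_mk, Function.comp_apply, if_pos ht']
      rfl
    rw [eVariationOn.eq_of_eqOn this]
    refine eVariationOn.comp_le_of_monotoneOn _ _ ?_ (fun _ _ => Set.mem_univ _)
    intro a _ b _ hab
    exact Set.monotone_projIcc _ (by have : (a : ℝ) ≤ b := hab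
                                     linarith)
  · have : Set.EqOn (γ.trans γ')
        (γ' ∘ fun t : unitInterval => Set.projIcc 0 1 zero_le_one (2 * (t : ℝ) - 1))
        (Set.Ici h) := by
      intro t ht
      have ht' : 1 / 2 ≤ (t : ℝ) := ht
      rcases ht'.eq_or_lt with h2 | h2
      · simp only [Path.trans, Path.coe_mk_mk, Function.comp_apply, if_pos h2.symm.le]
        rw [← h2]
        norm_num
      · simp only [Path.trans, Path.coe_mk_mk, Function.comp_apply, if_neg (not_le.2 h2)]
        rfl
    rw [eVariationOn.eq_of_eqOn this]
    refine eVariationOn.comp_le_of_monotoneOn _ _ ?_ (fun _ _ => Set.mem_univ _)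
    intro a _ b _ hab
    exact Set.monotone_projIcc _ (by have : (a : ℝ) ≤ b := hab
                                     linarith)

lemma innerDist_triangle (S : Set E) (x y z : E) :
    innerDist S x z ≤ innerDist S x y + innerDist S y z := by
  unfold innerDist
  refine ENNReal.le_iInf₂_add_iInf₂ fun γ hγ γ' hγ' => ?_
  exact (iInf₂_le (γ.trans γ') (by rw [Path.trans_range]; exact Set.union_subset hγ hγ')).trans
    (eVariationOn_trans_le γ γ')

end InnerDist

section Lipschitz

variable {E : Type*} [PseudoMetricSpace E]

/-- A Lipschitz curve lying in `S` bounds the inner distance of its end points. -/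
lemma innerDist_le_of_lipschitz {S : Set E} {c : ℝ → E} {a b K : ℝ} (hab : a ≤ b) (hK : 0 ≤ K)
    (hc : ∀ s ∈ Set.Icc a b, ∀ t ∈ Set.Icc a b, dist (c s) (c t) ≤ K * |s - t|)
    (hS : ∀ s ∈ Set.Icc a b, c s ∈ S) :
    innerDist S (c a) (c b) ≤ ENNReal.ofReal (K * (b - a)) := by
  have hseg : ∀ t : unitInterval, a + t * (b - a) ∈ Set.Icc a b := fun t =>
    ⟨by nlinarith [t.2.1], by nlinarith [t.2.2]⟩
  have hlip : LipschitzWith (Real.toNNReal (K * (b - a)))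
      (fun t : unitInterval => c (a + t * (b - a))) := by
    refine LipschitzWith.of_dist_le_mul fun s t => ?_
    rw [Real.coe_toNNReal _ (mul_nonneg hK (sub_nonneg.2 hab))]
    refine (hc _ (hseg s) _ (hseg t)).trans (le_of_eq ?_)
    have : a + s * (b - a) - (a + t * (b - a)) = (b - a) * ((s : ℝ) - t) := by ring
    rw [this, abs_mul, abs_of_nonneg (sub_nonneg.2 hab), Subtype.dist_eq, Real.dist_eq]
    ring
  let γ : Path (c a) (c b) :=
    { toFun := fun t : unitInterval => c (a + t * (b - a))
      continuous_toFun := hlip.continuous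
      source' := by simp
      target' := by simp }
  refine (iInf₂_le γ (by rintro _ ⟨t, rfl⟩; exact hS _ (hseg t))).trans ?_
  have h1 := (hlip.lipschitzOnWith (s := Set.univ)).comp_eVariationOn_le
    (g := (id : unitInterval → unitInterval)) (s := Set.univ) (fun _ _ => Set.mem_univ _)
  refine h1.trans ?_
  have h2 : eVariationOn (id : unitInterval → unitInterval) Set.univ ≤ 1 := by
    have h3 : eVariationOn (id : unitInterval → unitInterval) Set.univ
        = eVariationOn (fun t : unitInterval => (t : ℝ)) Set.univ := rfl
    have h4 := (show MonotoneOn (fun t : unitInterval => (t : ℝ)) Set.univ from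
      fun _ _ _ _ h => h).eVariationOn_eq (Set.mem_univ 0) (Set.mem_univ 1)
    rw [h3]
    have h5 : (Set.univ : Set unitInterval) ∩ Set.Icc 0 1 = Set.univ := by
      ext t; simpa using unitInterval.le_one'
    rw [h5] at h4
    simpa using h4.le
  calc _ ≤ ENNReal.ofReal (K * (b - a)) * 1 := by gcongr; exact le_rfl
    _ = _ := mul_one _

lemma innerDist_self {S : Set E} {x : E} (hx : x ∈ S) : innerDist S x x = 0 := by
  have := innerDist_le_of_lipschitz (S := S) (c := fun _ => x) (a := 0) (b := 0) (K := 0)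
    le_rfl le_rfl (by simp) (by simp [hx])
  simpa using this

lemma innerDist_le_ofReal_add {S : Set E} {x y z : E} {A B : ℝ} (hA : 0 ≤ A) (hB : 0 ≤ B)
    (h₁ : innerDist S x y ≤ ENNReal.ofReal A) (h₂ : innerDist S y z ≤ ENNReal.ofReal B) :
    innerDist S x z ≤ ENNReal.ofReal (A + B) := by
  rw [ENNReal.ofReal_add hA hB]
  exact (innerDist_triangle S x y z).trans (add_le_add h₁ h₂)

end Lipschitz

section Charts

variable {F : Type*} [NormedAddCommGroup F] [NormedSpace ℝ F]

lemma IsSmoothDiffeo.exists_hasStrictFDerivAt {Φ : OpenPartialHomeomorph F F}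
    (h : IsSmoothDiffeo Φ) {x : F} (hx : x ∈ Φ.source) :
    ∃ A : F ≃L[ℝ] F, HasStrictFDerivAt Φ (A : F →L[ℝ] F) x ∧
      HasStrictFDerivAt Φ.symm (A.symm : F →L[ℝ] F) (Φ x) := by
  have h1 : HasStrictFDerivAt Φ (fderiv ℝ Φ x) x :=
    (h.1.contDiffAt (Φ.open_source.mem_nhds hx)).hasStrictFDerivAt (by simp)
  have h2 : HasStrictFDerivAt Φ.symm (fderiv ℝ Φ.symm (Φ x)) (Φ x) :=
    (h.2.contDiffAt (Φ.open_target.mem_nhds (Φ.map_source hx))).hasStrictFDerivAt (by simp)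
  have h2' := h2.hasFDerivAt
  have h1' : HasFDerivAt Φ (fderiv ℝ Φ x) (Φ.symm (Φ x)) := by
    rw [Φ.left_inv hx]; exact h1.hasFDerivAt
  have e1 : (fderiv ℝ Φ.symm (Φ x)).comp (fderiv ℝ Φ x) = ContinuousLinearMap.id ℝ F :=
    ((h2'.comp x h1.hasFDerivAt).congr_of_eventuallyEq
      ((Φ.eventually_left_inverse hx).mono fun y hy => hy.symm)).unique (hasFDerivAt_id x)
  have e2 : (fderiv ℝ Φ x).comp (fderiv ℝ Φ.symm (Φ x)) = ContinuousLinearMap.id ℝ F :=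
    ((h1'.comp (Φ x) h2').congr_of_eventuallyEq
      ((Φ.eventually_right_inverse (Φ.map_source hx)).mono fun y hy => hy.symm)).unique
      (hasFDerivAt_id _)
  refine ⟨ContinuousLinearEquiv.equivOfInverse (fderiv ℝ Φ x) (fderiv ℝ Φ.symm (Φ x))
    (fun v => by simpa using congrArg (fun L => L v) e1)
    (fun v => by simpa using congrArg (fun L => L v) e2), h1, h2⟩

lemma hasDerivAt_comp_line {G : Type*} [NormedAddCommGroup G] [NormedSpace ℝ G]
    {f : F → G} {f' : F →L[ℝ] G} {y : F} (hf : HasStrictFDerivAt f f' y) (v : F) :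
    HasDerivAt (fun h : ℝ => f (y + h • v)) (f' v) 0 := by
  have h0 : HasDerivAt (fun h : ℝ => y + h • v) v 0 := by
    simpa using ((hasDerivAt_id (0 : ℝ)).smul_const v).const_add y
  have h1 : HasFDerivAt f f' (y + (0 : ℝ) • v) := by simpa using hf.hasFDerivAt
  exact h1.comp_hasDerivAt 0 h0

lemma tendsto_line (y v : F) : Tendsto (fun h : ℝ => y + h • v) (𝓝 0) (𝓝 y) := by
  have : Continuous (fun h : ℝ => y + h • v) := by fun_prop
  simpa using this.tendsto 0

lemma nonneg_of_hasDerivAt_of_eventually_nonneg {g : ℝ → ℝ} {g' : ℝ} (hg : HasDerivAt g g' 0)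
    (h0 : g 0 = 0) (hpos : ∀ᶠ h in 𝓝[>] (0 : ℝ), 0 ≤ g h) : 0 ≤ g' := by
  have h1 := hg.tendsto_slope_zero_right
  refine ge_of_tendsto h1 ?_
  filter_upwards [hpos, self_mem_nhdsWithin] with t ht ht0
  have : (0 : ℝ) < t := ht0
  simp only [zero_add, h0, sub_zero, smul_eq_mul]
  positivity

variable {N : Set F} {p : F} {Φ : OpenPartialHomeomorph F F} {V : Submodule ℝ F} {ℓ : F →L[ℝ] ℝ}

lemma IsBoundaryChart.eventually_symm_mem (h : IsBoundaryChart N p Φ V ℓ) (hp : p ∈ N) {v : F}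
    (hv : v ∈ V) (hℓ : 0 ≤ ℓ v) : ∀ᶠ s in 𝓝[>] (0 : ℝ), Φ.symm (Φ p + s • v) ∈ N := by
  have h1 : ∀ᶠ s in 𝓝 (0 : ℝ), Φ p + s • v ∈ Φ.target :=
    (tendsto_line (Φ p) v).eventually (Φ.open_target.mem_nhds (Φ.map_source h.mem_source))
  filter_upwards [nhdsWithin_le_nhds h1, self_mem_nhdsWithin] with s hs hs0
  have hs0 : 0 < s := hs0
  rw [h.mem_iff _ (Φ.map_target hs), Φ.right_inv hs]
  refine ⟨V.add_mem ((h.mem_iff p h.mem_source).1 hp).1 (V.smul_mem _ hv), ?_⟩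
  rw [map_add, map_smul, h.boundary, zero_add, smul_eq_mul]
  positivity

lemma IsBoundaryChart.exists_unit (h : IsBoundaryChart N p Φ V ℓ) : ∃ v ∈ V, ℓ v = 1 := by
  obtain ⟨v, hv, hne⟩ := h.nondegenerate
  exact ⟨(ℓ v)⁻¹ • v, V.smul_mem _ hv, by simp [hne]⟩

/-- A boundary point is not an interior point. -/
lemma IsBoundaryChart.not_isSmoothPoint [FiniteDimensional ℝ F] (h : IsBoundaryChart N p Φ V ℓ)
    (hp : p ∈ N) : ¬ IsSmoothPoint N p := by
  rintro ⟨Φ', V', hΦ', hpΦ', hmem⟩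
  obtain ⟨v, hv, hℓ⟩ := h.exists_unit
  obtain ⟨A, hA, hAs⟩ := h.smooth.exists_hasStrictFDerivAt h.mem_source
  obtain ⟨B, hB, hBs⟩ := hΦ'.exists_hasStrictFDerivAt hpΦ'
  have hB' : HasStrictFDerivAt Φ' (B : F →L[ℝ] F) (Φ.symm (Φ p)) := by
    rwa [Φ.left_inv h.mem_source]
  have hA' : HasStrictFDerivAt Φ (A : F →L[ℝ] F) (Φ'.symm (Φ' p)) := by
    rwa [Φ'.left_inv hpΦ']
  set w := B (A.symm v) with hw
  have hwV : w ∈ V' := by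
    have hd := (hasDerivAt_comp_line (hB'.comp (Φ p) hAs) v).tendsto_slope_zero_right
    refine V'.closed_of_finiteDimensional.mem_of_tendsto hd ?_
    have hsrc : ∀ᶠ s in 𝓝 (0 : ℝ), Φ.symm (Φ p + s • v) ∈ Φ'.source := by
      have := (hAs.hasFDerivAt.continuousAt.tendsto).comp (tendsto_line (Φ p) v)
      rw [Φ.left_inv h.mem_source] at this
      exact this.eventually (Φ'.open_source.mem_nhds hpΦ')
    filter_upwards [h.eventually_symm_mem hp hv (by rw [hℓ]; exact zero_le_one),
      nhdsWithin_le_nhds hsrc] with s hs hs'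
    refine V'.smul_mem _ (V'.sub_mem ?_ ?_)
    · simpa using (hmem _ hs').1 hs
    · simpa [Φ.left_inv h.mem_source] using (hmem _ hpΦ').1 hp
  have hd := hasDerivAt_comp_line
    ((ℓ.hasStrictFDerivAt (x := Φ (Φ'.symm (Φ' p)))).comp (Φ' p) (hA'.comp (Φ' p) hBs)) w
  have hmin : IsLocalMin (fun s : ℝ => (ℓ ∘ Φ ∘ Φ'.symm) (Φ' p + s • w)) 0 := by
    have ht : ∀ᶠ s in 𝓝 (0 : ℝ), Φ' p + s • w ∈ Φ'.target :=
      (tendsto_line (Φ' p) w).eventually (Φ'.open_target.mem_nhds (Φ'.map_source hpΦ'))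
    have hs : ∀ᶠ s in 𝓝 (0 : ℝ), Φ'.symm (Φ' p + s • w) ∈ Φ.source := by
      have := (hBs.hasFDerivAt.continuousAt.tendsto).comp (tendsto_line (Φ' p) w)
      rw [Φ'.left_inv hpΦ'] at this
      exact this.eventually (Φ.open_source.mem_nhds h.mem_source)
    filter_upwards [ht, hs] with s hs1 hs2
    have hN : Φ'.symm (Φ' p + s • w) ∈ N := by
      rw [hmem _ (Φ'.map_target hs1), Φ'.right_inv hs1]
      exact V'.add_mem ((hmem _ hpΦ').1 hp) (V'.smul_mem _ hwV)
    have := ((h.mem_iff _ hs2).1 hN).2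
    simpa [Φ'.left_inv hpΦ', h.boundary] using this
  have := hmin.hasDerivAt_eq_zero hd
  simp [hw, hℓ] at this

/-- Near a smooth point, the inner distance is comparable to the distance. -/
lemma IsSmoothPoint.exists_innerDist_le (hp : IsSmoothPoint N p) :
    ∃ C : ℝ, 0 ≤ C ∧ ∃ U ∈ 𝓝 p, ∀ x ∈ N ∩ U, ∀ y ∈ N ∩ U,
      innerDist N x y ≤ ENNReal.ofReal (C * dist x y) := by
  obtain ⟨Φ, V, hΦ, hpΦ, hmem⟩ := hp
  obtain ⟨A, hA, hAs⟩ := hΦ.exists_hasStrictFDerivAt hpΦ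
  obtain ⟨K, s, hs, hK⟩ := hA.exists_lipschitzOnWith
  obtain ⟨K', s', hs', hK'⟩ := hAs.exists_lipschitzOnWith
  obtain ⟨ε, hε, hball⟩ := Metric.mem_nhds_iff.1
    (inter_mem hs' (Φ.open_target.mem_nhds (Φ.map_source hpΦ)))
  refine ⟨K' * K, by positivity, s ∩ Φ.source ∩ Φ ⁻¹' Metric.ball (Φ p) ε,
    inter_mem (inter_mem hs (Φ.open_source.mem_nhds hpΦ))
      (hA.hasFDerivAt.continuousAt.preimage_mem_nhds (Metric.ball_mem_nhds _ hε)), ?_⟩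
  rintro x ⟨hxN, ⟨hxs, hxΦ⟩, hxb⟩ y ⟨hyN, ⟨hys, hyΦ⟩, hyb⟩
  have hx := (hmem x hxΦ).1 hxN
  have hy := (hmem y hyΦ).1 hyN
  have hseg : ∀ t ∈ Set.Icc (0 : ℝ) 1, Φ x + t • (Φ y - Φ x) ∈ Metric.ball (Φ p) ε :=
    fun t ht => (convex_ball (Φ p) ε).add_smul_sub_mem hxb hyb ht
  have key := innerDist_le_of_lipschitz (S := N)
    (c := fun t : ℝ => Φ.symm (Φ x + t • (Φ y - Φ x))) (a := 0) (b := 1)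
    (K := K' * (K * dist x y)) zero_le_one (by positivity) ?_ ?_
  · simpa [Φ.left_inv hxΦ, Φ.left_inv hyΦ, mul_assoc] using key
  · intro a ha b hb
    refine (hK'.dist_le_mul _ (hball (hseg a ha)).1 _ (hball (hseg b hb)).1).trans ?_
    rw [mul_assoc]
    refine mul_le_mul_of_nonneg_left ?_ K'.2
    rw [dist_add_left, dist_eq_norm, ← sub_smul, norm_smul, Real.norm_eq_abs, mul_comm]
    refine mul_le_mul_of_nonneg_right ?_ (abs_nonneg _)
    rw [← dist_eq_norm, dist_comm]
    exact hK.dist_le_mul _ hxs _ hys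
  · intro a ha
    have ht := (hball (hseg a ha)).2
    change Φ.symm _ ∈ N
    rw [hmem _ (Φ.map_target ht), Φ.right_inv ht]
    exact V.add_mem hx (V.smul_mem _ (V.sub_mem hy hx))

end Charts

section NormalForm

variable {E : Type*} [NormedAddCommGroup E] [InnerProductSpace ℝ E] [FiniteDimensional ℝ E]

/-- A bi-Lipschitz chart of a p-sub-manifold at a boundary point, in which the linear form
cutting out the half-space is the first coordinate of `[0, ∞) × 𝕊`. -/
lemma IsPSubmanifold.exists_normalForm {N : Set (ℝ × E)} (hN : IsPSubmanifold N) {p : ℝ × E}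
    (hp : p ∈ N) (hp0 : p.1 = 0) :
    ∃ (Ψ Θ : ℝ × E → ℝ × E) (V : Submodule ℝ (ℝ × E)) (ℓ : (ℝ × E) →L[ℝ] ℝ) (v₀ : ℝ × E)
      (K δ : ℝ) (U : Set (ℝ × E)), 0 ≤ K ∧ 0 < δ ∧ U ∈ 𝓝 p ∧ v₀ ∈ V ∧ ℓ v₀ = 1 ∧
      (∀ x ∈ N ∩ U, Ψ x ∈ V ∧ ℓ (Ψ x) = x.1 ∧ Θ (Ψ x) = x) ∧
      (∀ x ∈ U, ∀ y ∈ U, dist (Ψ x) (Ψ y) ≤ K * dist x y) ∧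
      (∀ y ∈ Metric.ball (Ψ p) δ, y ∈ V → 0 ≤ ℓ y → Θ y ∈ N ∧ (Θ y).1 = ℓ y) ∧
      (∀ x ∈ Metric.ball (Ψ p) δ, ∀ y ∈ Metric.ball (Ψ p) δ, dist (Θ x) (Θ y) ≤ K * dist x y) := by
  obtain ⟨hM, hsmooth, hbd⟩ := hN
  obtain ⟨Φ, V, ℓ, hΦ, htrans⟩ := hbd p hp hp0
  obtain ⟨v₀, hv₀, hℓ₀⟩ := hΦ.exists_unit
  obtain ⟨A, hA, hAs⟩ := hΦ.smooth.exists_hasStrictFDerivAt hΦ.mem_source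
  rw [hA.hasFDerivAt.fderiv] at htrans
  -- the differential of the first coordinate along `V`
  set fst := ContinuousLinearMap.fst ℝ ℝ E with hfst
  set τ : (ℝ × E) →L[ℝ] ℝ := fst.comp (A.symm : (ℝ × E) →L[ℝ] (ℝ × E)) with hτdef
  have hτs : HasStrictFDerivAt (fun y => (Φ.symm y).1) τ (Φ p) :=
    (fst.hasStrictFDerivAt (x := Φ.symm (Φ p))).comp (Φ p) hAs
  have hτnn : ∀ v ∈ V, 0 ≤ ℓ v → 0 ≤ τ v := by
    intro v hv hℓv
    refine nonneg_of_hasDerivAt_of_eventually_nonneg (hasDerivAt_comp_line hτs v) ?_ ?_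
    · simp [Φ.left_inv hΦ.mem_source, hp0]
    · exact (hΦ.eventually_symm_mem hp hv hℓv).mono fun s hs => (hM _ hs).1
  have hτker : ∀ v ∈ V, ℓ v = 0 → τ v = 0 := fun v hv h0 =>
    le_antisymm (by simpa using hτnn (-v) (V.neg_mem hv) (by simp [h0])) (hτnn v hv h0.ge)
  have hτ : ∀ v ∈ V, τ v = τ v₀ * ℓ v := by
    intro v hv
    have := hτker (v - ℓ v • v₀) (V.sub_mem hv (V.smul_mem _ hv₀)) (by simp [hℓ₀])
    rw [map_sub, map_smul, smul_eq_mul] at this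
    linarith
  have hτ₀ : 0 < τ v₀ := by
    refine lt_of_le_of_ne (hτnn v₀ hv₀ (by rw [hℓ₀]; exact zero_le_one)) fun h0 => ?_
    have h1 : ((1 : ℝ), (0 : E)) ∈ Submodule.prod (⊤ : Submodule ℝ ℝ) (ℝ ∙ p.2)ᗮ := by
      simp
    rw [← htrans] at h1
    obtain ⟨h, hh, k, hk, hhk⟩ := Submodule.mem_sup.1 h1
    have hk1 : k.1 = 0 := by simpa using hk.1
    have hh1 : h.1 = 1 := by simpa [hk1] using congrArg Prod.fst hhk
    have hhV : A h ∈ V := hh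
    have := hτ _ hhV
    rw [← h0, zero_mul] at this
    simp [hτdef, hfst, hh1] at this
  -- the straightened chart
  set Ψ : ℝ × E → ℝ × E := fun x => Φ x + (x.1 - ℓ (Φ x)) • v₀ with hΨ
  set D : (ℝ × E) →L[ℝ] (ℝ × E) :=
    (A : (ℝ × E) →L[ℝ] (ℝ × E)) + (fst - ℓ.comp (A : (ℝ × E) →L[ℝ] (ℝ × E))).smulRight v₀ with hD
  have hΨD : HasStrictFDerivAt Ψ D p :=
    hA.add (((fst.hasStrictFDerivAt (x := p)).sub
      ((ℓ.hasStrictFDerivAt (x := Φ p)).comp p hA)).smul_const v₀)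
  have hDinj : Function.Injective D := by
    refine (injective_iff_map_eq_zero D).2 fun h hh => ?_
    have hh' : A h + (h.1 - ℓ (A h)) • v₀ = 0 := hh
    have h1 : h.1 = 0 := by
      have := congrArg ℓ hh'
      simpa [hℓ₀] using this
    have hV : A h ∈ V := by
      rw [eq_neg_of_add_eq_zero_left hh']
      exact V.neg_mem (V.smul_mem _ hv₀)
    have h2 := hτ _ hV
    have h3 : τ (A h) = h.1 := by simp [hτdef, hfst]
    have h4 : ℓ (A h) = 0 := by
      rw [h3, h1] at h2
      rcases mul_eq_zero.1 h2.symm with h | h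
      · exact absurd h hτ₀.ne'
      · exact h
    rw [h1, h4, sub_zero, zero_smul, add_zero] at hh'
    exact A.map_eq_zero_iff.1 hh'
  set D' : (ℝ × E) ≃L[ℝ] (ℝ × E) :=
    (LinearEquiv.ofInjectiveEndo (D : (ℝ × E) →ₗ[ℝ] (ℝ × E)) hDinj).toContinuousLinearEquiv
  have hΨD' : HasStrictFDerivAt Ψ (D' : (ℝ × E) →L[ℝ] (ℝ × E)) p := by
    convert hΨD using 1
    exact ContinuousLinearMap.ext fun _ => rfl
  obtain ⟨K, s, hs, hK⟩ := hΨD'.exists_lipschitzOnWith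
  obtain ⟨K', s', hs', hK'⟩ := hΨD'.to_localInverse.exists_lipschitzOnWith
  have hℓΨ : ∀ x, ℓ (Ψ x) = x.1 := fun x => by simp [hΨ, hℓ₀]
  have hΨV : ∀ x, Ψ x ∈ V ↔ Φ x ∈ V := fun x =>
    V.add_mem_iff_left (V.smul_mem _ hv₀)
  -- near `p`, the half-space is cut out by the first coordinate
  have hsrc : ∀ᶠ x in 𝓝 p, x ∈ Φ.source := Φ.open_source.mem_nhds hΦ.mem_source
  have hzero : ∀ x ∈ Φ.source, Φ x ∈ V → ℓ (Φ x) = 0 → x.1 = 0 := by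
    intro x hx hxV hx0
    have hxN : x ∈ N := (hΦ.mem_iff x hx).2 ⟨hxV, hx0.ge⟩
    by_contra hne
    exact (IsBoundaryChart.not_isSmoothPoint ⟨hΦ.smooth, hx, hΦ.nondegenerate, hx0, hΦ.mem_iff⟩
      hxN) (hsmooth x hxN (lt_of_le_of_ne (hM x hxN).1 (Ne.symm hne)))
  have hside : ∀ᶠ x in 𝓝 p, Φ x ∈ V → 0 ≤ x.1 → 0 ≤ ℓ (Φ x) := by
    set η := τ v₀ / (2 * (‖v₀‖ + 1)) with hη
    have hηpos : 0 < η := by positivity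
    have hηv : η * ‖v₀‖ < τ v₀ := by
      have h1 : η * (2 * (‖v₀‖ + 1)) = τ v₀ := by
        rw [hη]; field_simp
      nlinarith [norm_nonneg v₀]
    have happ := (hasStrictFDerivAt_iff_isLittleO.1 hτs).def hηpos
    have hc1 : Tendsto Φ (𝓝 p) (𝓝 (Φ p)) := hA.hasFDerivAt.continuousAt.tendsto
    have hc2 : Tendsto (fun x => Φ x - ℓ (Φ x) • v₀) (𝓝 p) (𝓝 (Φ p)) := by
      have := hc1.sub (((ℓ.continuous.tendsto _).comp hc1).smul_const v₀)
      simpa [hΦ.boundary] using this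
    have hc3 : Tendsto (fun x => (Φ x, Φ x - ℓ (Φ x) • v₀)) (𝓝 p) (𝓝 (Φ p, Φ p)) :=
      hc1.prodMk_nhds hc2
    have htgt := hc2.eventually (Φ.open_target.mem_nhds (Φ.map_source hΦ.mem_source))
    filter_upwards [hsrc, hc3.eventually happ, htgt] with x hx hxa hxt hxV hx0
    by_contra hneg
    push Not at hneg
    have hy0 : (Φ.symm (Φ x - ℓ (Φ x) • v₀)).1 = 0 := by
      refine hzero _ (Φ.map_target hxt) ?_ ?_
      · rw [Φ.right_inv hxt]; exact V.sub_mem hxV (V.smul_mem _ hv₀)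
      · rw [Φ.right_inv hxt]; simp [hℓ₀]
    simp only [hy0, Φ.left_inv hx, sub_sub_cancel, map_smul, smul_eq_mul, norm_smul,
      Real.norm_eq_abs, sub_zero, abs_of_neg hneg] at hxa
    have := (abs_le.1 hxa).2
    nlinarith
  have hback : ∀ᶠ y in 𝓝 (Ψ p), hΨD'.localInverse Ψ D' p y ∈ Φ.source ∧
      (Φ (hΨD'.localInverse Ψ D' p y) ∈ V → 0 ≤ (hΨD'.localInverse Ψ D' p y).1 →
        0 ≤ ℓ (Φ (hΨD'.localInverse Ψ D' p y))) := by
    have h1 : Tendsto (hΨD'.localInverse Ψ D' p) (𝓝 (Ψ p)) (𝓝 p) := hΨD'.localInverse_tendsto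
    exact h1.eventually (hsrc.and hside)
  obtain ⟨δ, hδ, hball⟩ := Metric.mem_nhds_iff.1
    (inter_mem hs' (inter_mem hback hΨD'.eventually_right_inverse))
  refine ⟨Ψ, hΨD'.localInverse Ψ D' p, V, ℓ, v₀, max K K', δ,
    s ∩ Φ.source ∩ {x | hΨD'.localInverse Ψ D' p (Ψ x) = x}, le_max_of_le_left K.2, hδ,
    inter_mem (inter_mem hs hsrc) hΨD'.eventually_left_inverse, hv₀, hℓ₀, ?_, ?_, ?_, ?_⟩
  · rintro x ⟨hxN, ⟨_, hxΦ⟩, hxi⟩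
    exact ⟨(hΨV x).2 ((hΦ.mem_iff x hxΦ).1 hxN).1, hℓΨ x, hxi⟩
  · rintro x ⟨⟨hx, _⟩, _⟩ y ⟨⟨hy, _⟩, _⟩
    exact (hK.dist_le_mul x hx y hy).trans
      (mul_le_mul_of_nonneg_right (le_max_left _ _) dist_nonneg)
  · intro y hy hyV hy0
    obtain ⟨-, ⟨hyΦ, hyside⟩, hyr⟩ := hball hy
    have hyr : Ψ (hΨD'.localInverse Ψ D' p y) = y := hyr
    have h1 : (hΨD'.localInverse Ψ D' p y).1 = ℓ y := by rw [← hℓΨ, hyr]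
    have h2 : Φ (hΨD'.localInverse Ψ D' p y) ∈ V := by rwa [← hΨV, hyr]
    exact ⟨(hΦ.mem_iff _ hyΦ).2 ⟨h2, hyside h2 (by rwa [h1])⟩, h1⟩
  · intro x hx y hy
    exact (hK'.dist_le_mul x (hball hx).1 y (hball hy).1).trans
      (mul_le_mul_of_nonneg_right (le_max_right _ _) dist_nonneg)

end NormalForm

section RadialParametrization

/-- A parametrization `ψ : J → [0, ∞)` of the first factor of `[0, ∞) × 𝕊` by the distance `ρ` to
the vertex, such that the polar coordinates `(ψ ρ, u) ↦ ρ u` distort lengths in a controlled way.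
The two examples are `ρ ↦ ρ` near a vertex and `ρ ↦ ρ⁻¹` near infinity. -/
structure IsRadialParametrization (ψ : ℝ → ℝ) (J : Set ℝ) : Prop where
  nonneg : ∀ ρ ∈ J, 0 ≤ ρ
  Icc_subset : ∀ ρ ∈ J, ∀ ρ' ∈ J, Set.Icc ρ ρ' ⊆ J
  apply_nonneg : ∀ ρ ∈ J, 0 ≤ ψ ρ
  mul_abs_sub_le : ∀ ρ ∈ J, ∀ ρ' ∈ J, ρ ≤ ρ' → ρ * |ψ ρ - ψ ρ'| ≤ ρ' - ρ
  abs_sub_le : ∀ ρ ∈ J, ∀ ρ' ∈ J, ∀ σ ∈ Set.Icc ρ ρ', |ψ σ - ψ ρ'| ≤ |ψ ρ - ψ ρ'|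

lemma isRadialParametrization_id : IsRadialParametrization id (Set.Icc 0 1) where
  nonneg ρ h := h.1
  Icc_subset ρ h ρ' h' := Set.Icc_subset_Icc h.1 h'.2
  apply_nonneg ρ h := h.1
  mul_abs_sub_le ρ h ρ' h' hle := by
    simp only [id]
    rw [abs_sub_comm, abs_of_nonneg (sub_nonneg.2 hle)]
    nlinarith [h.2]
  abs_sub_le ρ h ρ' h' σ hσ := by
    simp only [id]
    rw [abs_sub_comm, abs_sub_comm ρ, abs_of_nonneg (sub_nonneg.2 hσ.2),
      abs_of_nonneg (sub_nonneg.2 (hσ.1.trans hσ.2))]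
    linarith [hσ.1]

lemma isRadialParametrization_inv : IsRadialParametrization (fun ρ => ρ⁻¹) (Set.Ici 1) where
  nonneg ρ h := zero_le_one.trans h
  Icc_subset ρ h ρ' h' := fun σ hσ => le_trans h hσ.1
  apply_nonneg ρ h := inv_nonneg.2 (zero_le_one.trans h)
  mul_abs_sub_le ρ h ρ' h' hle := by
    have h : 1 ≤ ρ := h
    have h' : 1 ≤ ρ' := h'
    have hρ : 0 < ρ := by linarith
    have hinv : ρ'⁻¹ ≤ ρ⁻¹ := inv_anti₀ hρ hle
    rw [abs_of_nonneg (sub_nonneg.2 hinv), mul_sub, mul_inv_cancel₀ hρ.ne']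
    have : 1 - ρ * ρ'⁻¹ = (ρ' - ρ) * ρ'⁻¹ := by
      have : ρ' ≠ 0 := by linarith
      field_simp
    rw [this]
    exact mul_le_of_le_one_right (sub_nonneg.2 hle) (inv_le_one_of_one_le₀ h')
  abs_sub_le ρ h ρ' h' σ hσ := by
    have h : 1 ≤ ρ := h
    have h1 : ρ'⁻¹ ≤ σ⁻¹ := inv_anti₀ (by linarith [hσ.1]) hσ.2
    have h2 : σ⁻¹ ≤ ρ⁻¹ := inv_anti₀ (by linarith) hσ.1
    rw [abs_of_nonneg (by linarith), abs_of_nonneg (by linarith)]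
    linarith

end RadialParametrization

section Polar

variable {E : Type*} [NormedAddCommGroup E] [NormedSpace ℝ E]

lemma abs_sub_le_dist_smul {ρ ρ' : ℝ} {u u' : E} (hρ : 0 ≤ ρ) (hρ' : 0 ≤ ρ') (hu : ‖u‖ = 1)
    (hu' : ‖u'‖ = 1) : |ρ - ρ'| ≤ dist (ρ • u) (ρ' • u') := by
  have := abs_norm_sub_norm_le (ρ • u) (ρ' • u')
  rwa [norm_smul, norm_smul, hu, hu', mul_one, mul_one, Real.norm_of_nonneg hρ,
    Real.norm_of_nonneg hρ', ← dist_eq_norm] at this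

lemma dist_smul_le_abs_sub_add {ρ ρ' : ℝ} {u u' : E} (hρ : 0 ≤ ρ) (hu' : ‖u'‖ = 1) :
    dist (ρ • u) (ρ' • u') ≤ |ρ - ρ'| + ρ * dist u u' := by
  have : ρ • u - ρ' • u' = (ρ - ρ') • u' + ρ • (u - u') := by module
  rw [dist_eq_norm, this, dist_eq_norm]
  refine (norm_add_le _ _).trans ?_
  rw [norm_smul, norm_smul, hu', mul_one, Real.norm_of_nonneg hρ, Real.norm_eq_abs]

lemma mul_dist_le_two_mul_dist_smul {ρ ρ' : ℝ} {u u' : E} (hρ : 0 ≤ ρ) (hρ' : 0 ≤ ρ')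
    (hu : ‖u‖ = 1) (hu' : ‖u'‖ = 1) : ρ * dist u u' ≤ 2 * dist (ρ • u) (ρ' • u') := by
  have h1 : ρ * dist u u' = dist (ρ • u) (ρ • u') := by
    rw [dist_smul₀, Real.norm_of_nonneg hρ]
  have h2 : dist (ρ' • u') (ρ • u') = |ρ - ρ'| := by
    rw [dist_eq_norm, ← sub_smul, norm_smul, hu', mul_one, Real.norm_eq_abs, abs_sub_comm]
  have h3 := dist_triangle (ρ • u) (ρ' • u') (ρ • u')
  linarith [abs_sub_le_dist_smul hρ hρ' hu hu']

end Polar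

section LocalEstimate

variable {E : Type*} [NormedAddCommGroup E] [InnerProductSpace ℝ E] [FiniteDimensional ℝ E]

/-- Near a boundary point of a p-sub-manifold, the inner distance in the image of polar
coordinates is comparable to the distance: one joins two points by first moving the one of larger
radius to the other radius, and then moving at constant radius. -/
lemma IsPSubmanifold.exists_innerDist_smul_le {ψ : ℝ → ℝ} {J : Set ℝ}
    (hψ : IsRadialParametrization ψ J) {N : Set (ℝ × E)} (hN : IsPSubmanifold N) {p : ℝ × E}
    (hp : p ∈ N) (hp0 : p.1 = 0) {S : Set E} {b : E}
    (hS : ∀ ρ ∈ J, ∀ u, (ψ ρ, u) ∈ N → b + ρ • u ∈ S) :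
    ∃ C : ℝ, 0 ≤ C ∧ ∃ U ∈ 𝓝 p, ∀ ρ ∈ J, ∀ ρ' ∈ J, ∀ u u', (ψ ρ, u) ∈ N ∩ U →
      (ψ ρ', u') ∈ N ∩ U →
      innerDist S (b + ρ • u) (b + ρ' • u') ≤ ENNReal.ofReal (C * dist (ρ • u) (ρ' • u')) := by
  obtain ⟨Ψ, Θ, V, ℓ, v₀, K, δ, U, hK, hδ, hU, hv₀, hℓ₀, hΨ, hΨK, hΘ, hΘK⟩ :=
    hN.exists_normalForm hp hp0
  set r := min (δ / (3 * (K + 1))) (δ / (6 * (‖v₀‖ + 1))) with hr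
  have hr0 : 0 < r := lt_min (by positivity) (by positivity)
  have hr1 : K * r ≤ δ / 3 := by
    have h1 : r * (3 * (K + 1)) ≤ δ := (le_div_iff₀ (by positivity)).1 (min_le_left _ _)
    nlinarith
  have hr2 : r * ‖v₀‖ ≤ δ / 6 := by
    have h1 : r * (6 * (‖v₀‖ + 1)) ≤ δ := (le_div_iff₀ (by positivity)).1 (min_le_right _ _)
    nlinarith
  refine ⟨(1 + K * ‖v₀‖) + K * (3 * K + ‖v₀‖), by positivity, U ∩ Metric.ball p r,
    inter_mem hU (Metric.ball_mem_nhds _ hr0), ?_⟩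
  intro ρ hρ ρ' hρ' u u' hx hx'
  wlog hle : ρ ≤ ρ' generalizing ρ ρ' u u'
  · rw [innerDist_comm, dist_comm]
    exact this ρ' hρ' ρ hρ u' u hx' hx (le_of_not_ge hle)
  obtain ⟨hxN, hxU, hxr⟩ := hx
  obtain ⟨hxN', hxU', hxr'⟩ := hx'
  obtain ⟨hzV, hzℓ, hzΘ⟩ := hΨ _ ⟨hxN, hxU⟩
  obtain ⟨hzV', hzℓ', hzΘ'⟩ := hΨ _ ⟨hxN', hxU'⟩
  have hu : ‖u‖ = 1 := (hN.1 _ hxN).2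
  have hu' : ‖u'‖ = 1 := (hN.1 _ hxN').2
  have hρ0 := hψ.nonneg ρ hρ
  have hρ0' := hψ.nonneg ρ' hρ'
  have hzK := hΨK _ hxU _ hxU'
  have hcz : ∀ x ∈ U ∩ Metric.ball p r, dist (Ψ x) (Ψ p) ≤ δ / 3 := fun x hx =>
    ((hΨK x hx.1 p (mem_of_mem_nhds hU)).trans
      (mul_le_mul_of_nonneg_left (Metric.mem_ball.1 hx.2).le hK)).trans hr1
  have hz1 := hcz _ ⟨hxU, hxr⟩
  have hz1' := hcz _ ⟨hxU', hxr'⟩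
  set z := Ψ (ψ ρ, u) with hz
  set z' := Ψ (ψ ρ', u') with hz'
  set d := dist (ρ • u) (ρ' • u') with hd
  set m := |ψ ρ - ψ ρ'| with hm
  have hm2 : m * ‖v₀‖ ≤ δ / 3 := by
    have h1 : |ψ ρ| ≤ r := by
      have := (Metric.mem_ball.1 hxr).le
      rw [Prod.dist_eq, hp0] at this
      simpa using (le_max_left _ _).trans this
    have h2 : |ψ ρ'| ≤ r := by
      have := (Metric.mem_ball.1 hxr').le
      rw [Prod.dist_eq, hp0] at this
      simpa using (le_max_left _ _).trans this
    have h3 : m ≤ r + r := (abs_sub _ _).trans (add_le_add h1 h2)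
    nlinarith [norm_nonneg v₀]
  have hρm : ρ * m ≤ d := (hψ.mul_abs_sub_le ρ hρ ρ' hρ' hle).trans
    (by rw [← abs_of_nonneg (sub_nonneg.2 hle), abs_sub_comm]
        exact abs_sub_le_dist_smul hρ0 hρ0' hu hu')
  have hρu : ρ * dist u u' ≤ 2 * d := mul_dist_le_two_mul_dist_smul hρ0 hρ0' hu hu'
  -- moving along the radial direction
  have hy : ∀ σ ∈ Set.Icc ρ ρ', z' + (ψ σ - ψ ρ') • v₀ ∈ Metric.ball (Ψ p) δ := by
    intro σ hσ
    have h1 : dist (z' + (ψ σ - ψ ρ') • v₀) z' ≤ δ / 3 := by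
      rw [dist_self_add_left, norm_smul, Real.norm_eq_abs]
      exact (mul_le_mul_of_nonneg_right (hψ.abs_sub_le ρ hρ ρ' hρ' σ hσ)
        (norm_nonneg _)).trans hm2
    have h2 := dist_triangle (z' + (ψ σ - ψ ρ') • v₀) z' (Ψ p)
    rw [Metric.mem_ball]
    linarith
  have hyN : ∀ σ ∈ Set.Icc ρ ρ', Θ (z' + (ψ σ - ψ ρ') • v₀) ∈ N ∧
      (Θ (z' + (ψ σ - ψ ρ') • v₀)).1 = ψ σ := by
    intro σ hσ
    have hℓ : ℓ (z' + (ψ σ - ψ ρ') • v₀) = ψ σ := by simp [hzℓ', hℓ₀]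
    have := hΘ _ (hy σ hσ) (V.add_mem hzV' (V.smul_mem _ hv₀))
      (by rw [hℓ]; exact hψ.apply_nonneg σ (hψ.Icc_subset ρ hρ ρ' hρ' hσ))
    rwa [hℓ] at this
  have leg₁ : innerDist S (b + ρ • (Θ (z' + (ψ ρ - ψ ρ') • v₀)).2) (b + ρ' • u')
      ≤ ENNReal.ofReal ((1 + K * ‖v₀‖) * (ρ' - ρ)) := by
    have key := innerDist_le_of_lipschitz (S := S)
      (c := fun σ : ℝ => b + σ • (Θ (z' + (ψ σ - ψ ρ') • v₀)).2) (a := ρ) (b := ρ')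
      (K := 1 + K * ‖v₀‖) hle (by positivity) ?_ ?_
    · simpa [hzΘ'] using key
    · intro σ hσ τ hτ
      wlog hστ : σ ≤ τ generalizing σ τ
      · rw [dist_comm, abs_sub_comm]
        exact this τ hτ σ hσ (le_of_not_ge hστ)
      have hσJ := hψ.Icc_subset ρ hρ ρ' hρ' hσ
      have hτJ := hψ.Icc_subset ρ hρ ρ' hρ' hτ
      have hσ0 := hψ.nonneg σ hσJ
      rw [dist_add_left]
      refine (dist_smul_le_abs_sub_add hσ0 (hN.1 _ (hyN τ hτ).1).2).trans ?_
      have h1 : dist (Θ (z' + (ψ σ - ψ ρ') • v₀)).2 (Θ (z' + (ψ τ - ψ ρ') • v₀)).2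
          ≤ K * (|ψ σ - ψ τ| * ‖v₀‖) := by
        refine ((le_max_right _ _).trans_eq (Prod.dist_eq ..).symm).trans
          ((hΘK _ (hy σ hσ) _ (hy τ hτ)).trans (mul_le_mul_of_nonneg_left ?_ hK))
        rw [dist_add_left, dist_eq_norm, ← sub_smul, norm_smul, Real.norm_eq_abs,
          sub_sub_sub_cancel_right]
      have h2 := hψ.mul_abs_sub_le σ hσJ τ hτJ hστ
      have h3 := mul_le_mul_of_nonneg_left h1 hσ0
      have h4 := mul_le_mul_of_nonneg_left h2 (mul_nonneg hK (norm_nonneg v₀))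
      rw [abs_sub_comm σ τ, abs_of_nonneg (sub_nonneg.2 hστ)]
      nlinarith
    · intro σ hσ
      refine hS σ (hψ.Icc_subset ρ hρ ρ' hρ' hσ) _ ?_
      have := hyN σ hσ
      convert this.1 using 1
      exact Prod.ext this.2.symm rfl
  -- moving at constant radius
  set y₀ := z' + (ψ ρ - ψ ρ') • v₀ with hy₀
  have hρI : ρ ∈ Set.Icc ρ ρ' := ⟨le_rfl, hle⟩
  have hw : ∀ θ ∈ Set.Icc (0 : ℝ) 1, y₀ + θ • (z - y₀) ∈ Metric.ball (Ψ p) δ := fun θ hθ =>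
    (convex_ball _ _).add_smul_sub_mem (hy ρ hρI) (Metric.mem_ball.2 (by linarith)) hθ
  have hy₀V : y₀ ∈ V := V.add_mem hzV' (V.smul_mem _ hv₀)
  have hy₀ℓ : ℓ y₀ = ψ ρ := by simp [hy₀, hzℓ', hℓ₀]
  have hyz : ρ * dist y₀ z ≤ (3 * K + ‖v₀‖) * d := by
    have h1 : dist y₀ z' = m * ‖v₀‖ := by
      rw [dist_self_add_left, norm_smul, Real.norm_eq_abs]
    have h2 : dist z z' ≤ K * (m + dist u u') := by
      refine hzK.trans (mul_le_mul_of_nonneg_left ?_ hK)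
      rw [Prod.dist_eq]
      exact max_le (le_add_of_nonneg_right dist_nonneg) (le_add_of_nonneg_left (abs_nonneg _))
    have h3 : dist y₀ z ≤ m * ‖v₀‖ + K * (m + dist u u') := by
      have := dist_triangle y₀ z' z
      rw [dist_comm z' z] at this
      linarith
    have h4 := mul_le_mul_of_nonneg_left h3 hρ0
    have h5 := mul_le_mul_of_nonneg_left hρm (norm_nonneg v₀)
    have h6 := mul_le_mul_of_nonneg_left (add_le_add hρm hρu) hK
    nlinarith
  have leg₂ : innerDist S (b + ρ • (Θ y₀).2) (b + ρ • u)
      ≤ ENNReal.ofReal (K * ((3 * K + ‖v₀‖) * d)) := by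
    have key := innerDist_le_of_lipschitz (S := S)
      (c := fun θ : ℝ => b + ρ • (Θ (y₀ + θ • (z - y₀))).2) (a := 0) (b := 1)
      (K := K * ((3 * K + ‖v₀‖) * d)) zero_le_one (by positivity) ?_ ?_
    · simpa [hzΘ] using key
    · intro θ hθ θ' hθ'
      rw [dist_add_left, dist_smul₀, Real.norm_of_nonneg hρ0]
      have h1 : dist (Θ (y₀ + θ • (z - y₀))).2 (Θ (y₀ + θ' • (z - y₀))).2
          ≤ K * (|θ - θ'| * dist y₀ z) := by
        refine ((le_max_right _ _).trans_eq (Prod.dist_eq ..).symm).trans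
          ((hΘK _ (hw θ hθ) _ (hw θ' hθ')).trans (mul_le_mul_of_nonneg_left ?_ hK))
        rw [dist_add_left, dist_eq_norm, ← sub_smul, norm_smul, Real.norm_eq_abs,
          ← dist_eq_norm, dist_comm]
      have h2 := mul_le_mul_of_nonneg_left h1 hρ0
      have h3 := mul_le_mul_of_nonneg_left hyz (mul_nonneg hK (abs_nonneg (θ - θ')))
      nlinarith
    · intro θ hθ
      have hℓ : ℓ (y₀ + θ • (z - y₀)) = ψ ρ := by simp [hy₀ℓ, hzℓ]
      have := hΘ _ (hw θ hθ) (V.add_mem hy₀V (V.smul_mem _ (V.sub_mem hzV hy₀V)))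
        (by rw [hℓ]; exact hψ.apply_nonneg ρ hρ)
      refine hS ρ hρ _ ?_
      rw [hℓ] at this
      convert this.1 using 1
      exact Prod.ext this.2.symm rfl
  have hd0 : 0 ≤ d := dist_nonneg
  have hρd : ρ' - ρ ≤ d := by
    rw [← abs_of_nonneg (sub_nonneg.2 hle), abs_sub_comm]
    exact abs_sub_le_dist_smul hρ0 hρ0' hu hu'
  rw [innerDist_comm] at leg₂
  refine (innerDist_le_ofReal_add (by positivity)
    (mul_nonneg (by positivity) (sub_nonneg.2 hle)) leg₂ leg₁).trans (ENNReal.ofReal_le_ofReal ?_)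
  have := mul_le_mul_of_nonneg_left hρd (show 0 ≤ 1 + K * ‖v₀‖ by positivity)
  linarith

end LocalEstimate

section Compactness

lemma _root_.IsCompact.exists_eventually_nhdsSet {X : Type*} [TopologicalSpace X] {K : Set X}
    (hK : IsCompact K) {Q : ℝ → X → Prop} (hmono : ∀ C C' x, C ≤ C' → Q C x → Q C' x)
    (h : ∀ x ∈ K, ∃ C, ∀ᶠ y in 𝓝 x, Q C y) : ∃ C, 0 ≤ C ∧ ∀ᶠ y in 𝓝ˢ K, Q C y := by
  refine hK.induction_on (p := fun s => ∃ C, 0 ≤ C ∧ ∀ᶠ y in 𝓝ˢ s, Q C y)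
    ⟨0, le_rfl, by simp⟩ ?_ ?_ ?_
  · rintro s t hst ⟨C, hC, h⟩
    exact ⟨C, hC, h.filter_mono (nhdsSet_mono hst)⟩
  · rintro s t ⟨C, hC, h⟩ ⟨C', hC', h'⟩
    refine ⟨max C C', le_max_of_le_left hC, ?_⟩
    rw [nhdsSet_union]
    exact eventually_sup.2 ⟨h.mono fun x => hmono _ _ x (le_max_left _ _),
      h'.mono fun x => hmono _ _ x (le_max_right _ _)⟩
  · intro x hx
    obtain ⟨C, hC⟩ := h x hx
    obtain ⟨U, hU, hUo, hxU⟩ := eventually_nhds_iff.1 hC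
    refine ⟨U, nhdsWithin_le_nhds (hUo.mem_nhds hxU), max C 0, le_max_right _ _, ?_⟩
    rw [hUo.nhdsSet_eq]
    exact eventually_principal.2 fun y hy => hmono _ _ y (le_max_left _ _) (hU y hy)

variable {E : Type*} [NormedAddCommGroup E] [InnerProductSpace ℝ E] [FiniteDimensional ℝ E]
  {Z : Set (ℝ × E)}

lemma isCompact_inter_fst_le (hZ : IsClosed Z) (hZM : ∀ p ∈ Z, 0 ≤ p.1 ∧ ‖p.2‖ = 1) (c : ℝ) :
    IsCompact (Z ∩ {p | p.1 ≤ c}) := by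
  have : ProperSpace E := FiniteDimensional.proper ℝ E
  refine (isCompact_Icc.prod (isCompact_sphere (0 : E) 1)).of_isClosed_subset (s := Set.Icc 0 c ×ˢ _)
    (hZ.inter (isClosed_le continuous_fst continuous_const)) ?_
  rintro p ⟨hp, hpc⟩
  exact ⟨⟨(hZM p hp).1, hpc⟩, by simpa using (hZM p hp).2⟩

lemma exists_forall_fst_lt_of_eventually (hZ : IsClosed Z)
    (hZM : ∀ p ∈ Z, 0 ≤ p.1 ∧ ‖p.2‖ = 1) {Q : ℝ × E → Prop}
    (hQ : ∀ᶠ x in 𝓝ˢ (Z ∩ {p | p.1 ≤ 0}), Q x) : ∃ m > 0, ∀ x ∈ Z, x.1 < m → Q x := by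
  obtain ⟨U, hU, hKU, hUQ⟩ := mem_nhdsSet_iff_exists.1 hQ
  have hcomp : IsCompact ((Z ∩ {p | p.1 ≤ 1}) \ U) := (isCompact_inter_fst_le hZ hZM 1).diff hU
  rcases Set.eq_empty_or_nonempty ((Z ∩ {p | p.1 ≤ 1}) \ U) with he | hne
  · refine ⟨1, one_pos, fun x hx hx1 => hUQ ?_⟩
    by_contra hxU
    have : x ∈ (Z ∩ {p | p.1 ≤ 1}) \ U := ⟨⟨hx, hx1.le⟩, hxU⟩
    rw [he] at this
    exact this
  · obtain ⟨x₀, hx₀, hmin⟩ := hcomp.exists_isMinOn hne continuous_fst.continuousOn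
    have hpos : 0 < x₀.1 := by
      by_contra hle
      exact hx₀.2 (hKU ⟨hx₀.1.1, not_lt.1 hle⟩)
    refine ⟨min x₀.1 1, lt_min hpos one_pos, fun x hx hxm => hUQ ?_⟩
    by_contra hxU
    have : x₀.1 ≤ x.1 := hmin (show x ∈ (Z ∩ {p | p.1 ≤ 1}) \ U from
      ⟨⟨hx, (hxm.trans_le (min_le_right _ _)).le⟩, hxU⟩)
    exact absurd (hxm.trans_le (min_le_left _ _)) (not_lt.2 this)

/-- The inner distance in an end of conic type is comparable to the distance, provided that the
distance to a base point is radially bounded along the end. -/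
lemma exists_innerDist_le_of_end {ψ : ℝ → ℝ} {J : Set ℝ} (hψ : IsRadialParametrization ψ J)
    (hZ : IsClosed Z) (hZM : ∀ p ∈ Z, 0 ≤ p.1 ∧ ‖p.2‖ = 1) {W : Set (ℝ × E)} (hW : IsOpen W)
    (hZW : ∀ p ∈ Z, p.1 ≤ 0 → p ∈ W) (hN : IsPSubmanifold (Z ∩ W)) {S : Set E} {b o : E}
    (hS : ∀ ρ ∈ J, ∀ u, (ψ ρ, u) ∈ Z ∩ W → b + ρ • u ∈ S)
    (hrad : ∀ p ∈ Z ∩ W, p.1 = 0 → ∃ C : ℝ, ∃ U ∈ 𝓝 p, ∀ ρ ∈ J, ∀ u,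
      (ψ ρ, u) ∈ Z ∩ W ∩ U → innerDist S o (b + ρ • u) ≤ ENNReal.ofReal (C * ρ)) :
    ∃ m > 0, ∃ C : ℝ, 0 ≤ C ∧
      (∀ ρ ∈ J, ∀ ρ' ∈ J, ∀ u u', ψ ρ < m → ψ ρ' < m → (ψ ρ, u) ∈ Z → (ψ ρ', u') ∈ Z →
        innerDist S (b + ρ • u) (b + ρ' • u') ≤ ENNReal.ofReal (C * dist (ρ • u) (ρ' • u'))) ∧
      (∀ ρ ∈ J, ∀ u, ψ ρ < m → (ψ ρ, u) ∈ Z →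
        innerDist S o (b + ρ • u) ≤ ENNReal.ofReal (C * ρ)) := by
  have hK := isCompact_inter_fst_le hZ hZM 0
  have hK0 : ∀ p ∈ Z ∩ {p | p.1 ≤ 0}, p ∈ Z ∩ W ∧ p.1 = 0 := fun p hp =>
    ⟨⟨hp.1, hZW p hp.1 hp.2⟩, le_antisymm hp.2 (hZM p hp.1).1⟩
  -- the radial bound
  have hrad' : ∀ p ∈ Z ∩ {p | p.1 ≤ 0}, ∃ C, ∀ᶠ x in 𝓝 p, ∀ ρ ∈ J, ∀ u, x = (ψ ρ, u) → x ∈ Z →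
      innerDist S o (b + ρ • u) ≤ ENNReal.ofReal (C * ρ) := by
    intro p hp
    obtain ⟨C, U, hU, h⟩ := hrad p (hK0 p hp).1 (hK0 p hp).2
    refine ⟨C, ?_⟩
    filter_upwards [hU, hW.mem_nhds (hK0 p hp).1.2] with x hxU hxW ρ hρ u hx hxZ
    subst hx
    exact h ρ hρ u ⟨⟨hxZ, hxW⟩, hxU⟩
  obtain ⟨C₁, hC₁, h₁⟩ := hK.exists_eventually_nhdsSet
    (fun C C' x hCC' h ρ hρ u hx hxZ => (h ρ hρ u hx hxZ).trans (ENNReal.ofReal_le_ofReal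
      (mul_le_mul_of_nonneg_right hCC' (hψ.nonneg ρ hρ)))) hrad'
  obtain ⟨m₁, hm₁, h₁⟩ := exists_forall_fst_lt_of_eventually hZ hZM h₁
  -- pairs of points
  have hpair : ∀ pq ∈ (Z ∩ {p | p.1 ≤ 0}) ×ˢ (Z ∩ {p | p.1 ≤ 0}), ∃ C,
      ∀ᶠ xy : (ℝ × E) × (ℝ × E) in 𝓝 pq, ∀ ρ ∈ J, ∀ ρ' ∈ J, ∀ u u', xy.1 = (ψ ρ, u) →
        xy.2 = (ψ ρ', u') → xy.1 ∈ Z → xy.2 ∈ Z →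
        innerDist S (b + ρ • u) (b + ρ' • u') ≤
          ENNReal.ofReal (C * dist (ρ • u) (ρ' • u')) := by
    rintro ⟨p, q⟩ ⟨hp, hq⟩
    by_cases hpq : p = q
    · subst hpq
      obtain ⟨C, -, U, hU, h⟩ := hN.exists_innerDist_smul_le hψ (hK0 p hp).1 (hK0 p hp).2 hS
      refine ⟨C, ?_⟩
      have hUW : U ∩ W ∈ 𝓝 p := inter_mem hU (hW.mem_nhds (hK0 p hp).1.2)
      filter_upwards [prod_mem_nhds hUW hUW]
      rintro ⟨x, y⟩ ⟨hx, hy⟩ ρ hρ ρ' hρ' u u' hxe hye hxZ hyZ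
      simp only at hx hy hxe hye hxZ hyZ
      subst hxe hye
      exact h ρ hρ ρ' hρ' u u' ⟨⟨hxZ, hx.2⟩, hx.1⟩ ⟨⟨hyZ, hy.2⟩, hy.1⟩
    · have hne : p.2 ≠ q.2 := fun h =>
        hpq (Prod.ext ((hK0 p hp).2.trans (hK0 q hq).2.symm) h)
      set c := dist p.2 q.2 / 2 with hc
      have hd0 : 0 < dist p.2 q.2 := dist_pos.2 hne
      have hc0 : 0 < c := half_pos hd0
      obtain ⟨C, hC⟩ := hrad' p hp
      obtain ⟨C', hC'⟩ := hrad' q hq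
      refine ⟨(max C 0 + max C' 0) * (2 / c), ?_⟩
      have hfar : ∀ᶠ xy : (ℝ × E) × (ℝ × E) in 𝓝 (p, q), c < dist xy.1.2 xy.2.2 := by
        have : Continuous fun xy : (ℝ × E) × (ℝ × E) => dist xy.1.2 xy.2.2 := by fun_prop
        exact this.continuousAt.eventually_const_lt (show c < dist p.2 q.2 by rw [hc]; linarith)
      filter_upwards [hfar, (hC.prod_nhds hC')]
      rintro ⟨x, y⟩ hxy ⟨hx, hy⟩ ρ hρ ρ' hρ' u u' hxe hye hxZ hyZ
      simp only at hx hy hxe hye hxZ hyZ hxy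
      have e1 := hx ρ hρ u hxe hxZ
      have e2 := hy ρ' hρ' u' hye hyZ
      subst hxe hye
      have hρ0 := hψ.nonneg ρ hρ
      have hρ0' := hψ.nonneg ρ' hρ'
      rw [innerDist_comm] at e1
      replace e1 := e1.trans (ENNReal.ofReal_le_ofReal
        (mul_le_mul_of_nonneg_right (le_max_left C 0) hρ0))
      replace e2 := e2.trans (ENNReal.ofReal_le_ofReal
        (mul_le_mul_of_nonneg_right (le_max_left C' 0) hρ0'))
      refine (innerDist_le_ofReal_add (by positivity) (by positivity) e1 e2).trans
        (ENNReal.ofReal_le_ofReal ?_)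
      have hu : ‖u‖ = 1 := (hZM _ hxZ).2
      have hu' : ‖u'‖ = 1 := (hZM _ hyZ).2
      have f1 := mul_dist_le_two_mul_dist_smul hρ0 hρ0' hu hu'
      have f2 := mul_dist_le_two_mul_dist_smul hρ0' hρ0 hu' hu
      rw [dist_comm u' u, dist_comm (ρ' • u')] at f2
      have g1 : ρ ≤ 2 / c * dist (ρ • u) (ρ' • u') := by
        rw [div_mul_eq_mul_div, le_div_iff₀ hc0]
        exact (mul_le_mul_of_nonneg_left hxy.le hρ0).trans f1
      have g2 : ρ' ≤ 2 / c * dist (ρ • u) (ρ' • u') := by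
        rw [div_mul_eq_mul_div, le_div_iff₀ hc0]
        exact (mul_le_mul_of_nonneg_left hxy.le hρ0').trans f2
      have := mul_le_mul_of_nonneg_left g1 (le_max_right C 0)
      have := mul_le_mul_of_nonneg_left g2 (le_max_right C' 0)
      linarith
  obtain ⟨C₂, hC₂, h₂⟩ := (hK.prod hK).exists_eventually_nhdsSet
    (fun C C' x hCC' h ρ hρ ρ' hρ' u u' hx hy hxZ hyZ => (h ρ hρ ρ' hρ' u u' hx hy hxZ hyZ).trans
      (ENNReal.ofReal_le_ofReal (mul_le_mul_of_nonneg_right hCC' dist_nonneg))) hpair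
  rw [hK.nhdsSet_prod_eq hK] at h₂
  obtain ⟨T, hT, h₂⟩ := eventually_prod_self_iff'.1 h₂
  obtain ⟨m₂, hm₂, hT⟩ := exists_forall_fst_lt_of_eventually hZ hZM (Q := (· ∈ T)) hT
  refine ⟨min m₁ m₂, lt_min hm₁ hm₂, max C₁ C₂, le_max_of_le_left hC₁, ?_, ?_⟩
  · intro ρ hρ ρ' hρ' u u' hm hm' hx hx'
    exact (h₂ _ (hT _ hx (hm.trans_le (min_le_right _ _))) _
      (hT _ hx' (hm'.trans_le (min_le_right _ _))) ρ hρ ρ' hρ' u u' rfl rfl hx hx').trans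
      (ENNReal.ofReal_le_ofReal (mul_le_mul_of_nonneg_right (le_max_right _ _) dist_nonneg))
  · intro ρ hρ u hm hx
    exact (h₁ _ hx (hm.trans_le (min_le_left _ _)) ρ hρ u rfl hx).trans
      (ENNReal.ofReal_le_ofReal (mul_le_mul_of_nonneg_right (le_max_left _ _) (hψ.nonneg ρ hρ)))

end Compactness

section ConicPoint

lemma isClosed_nonneg_prod_sphere {E : Type*} [NormedAddCommGroup E] :
    IsClosed {p : ℝ × E | 0 ≤ p.1 ∧ ‖p.2‖ = 1} :=
  (isClosed_le continuous_const continuous_fst).inter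
    (isClosed_eq continuous_snd.norm continuous_const)

lemma norm_inv_norm_smul {E : Type*} [NormedAddCommGroup E] [NormedSpace ℝ E] {x : E}
    (hx : x ≠ 0) : ‖‖x‖⁻¹ • x‖ = 1 := by
  rw [norm_smul, norm_inv, norm_norm, inv_mul_cancel₀ (norm_ne_zero_iff.2 hx)]

variable {E : Type*} [NormedAddCommGroup E] [InnerProductSpace ℝ E] [FiniteDimensional ℝ E]
  {X : Set E} {a : E}

lemma IsConicPoint.exists_innerDist_le (hX : IsClosed X) (ha : IsConicPoint X a) :
    ∃ C : ℝ, 0 ≤ C ∧ ∃ U ∈ 𝓝 a, ∀ x ∈ X ∩ U, ∀ y ∈ X ∩ U,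
      innerDist X x y ≤ ENNReal.ofReal (C * dist x y) := by
  obtain ⟨haX, -, r, hr, hN⟩ := ha
  have hZM : ∀ p ∈ strictTransform (X ∩ Metric.ball a r) a, 0 ≤ p.1 ∧ ‖p.2‖ = 1 :=
    closure_minimal (fun p hp => ⟨hp.1.le, hp.2.1⟩) isClosed_nonneg_prod_sphere
  have hZX : ∀ p ∈ strictTransform (X ∩ Metric.ball a r) a, a + p.1 • p.2 ∈ X :=
    closure_minimal (fun p hp => hp.2.2.1) (hX.preimage (by fun_prop))
  have hS : ∀ ρ ∈ Set.Icc (0 : ℝ) 1, ∀ u, (id ρ, u) ∈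
      strictTransform (X ∩ Metric.ball a r) a ∩ {p | p.1 < r} → a + ρ • u ∈ X :=
    fun ρ _ u h => hZX _ h.1
  have hvert : ∀ p ∈ strictTransform (X ∩ Metric.ball a r) a ∩ {p | p.1 < r}, p.1 = 0 →
      ∃ C : ℝ, ∃ U ∈ 𝓝 p, ∀ ρ ∈ Set.Icc (0 : ℝ) 1, ∀ u,
        (id ρ, u) ∈ strictTransform (X ∩ Metric.ball a r) a ∩ {p | p.1 < r} ∩ U →
        innerDist X a (a + ρ • u) ≤ ENNReal.ofReal (C * ρ) := by
    intro p hp hp0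
    obtain ⟨C, -, U, hU, h⟩ := hN.exists_innerDist_smul_le isRadialParametrization_id hp hp0 hS
    refine ⟨C, U, hU, fun ρ hρ u hu => ?_⟩
    have hp' : (id (0 : ℝ), p.2) = p := Prod.ext hp0.symm rfl
    have := h 0 ⟨le_rfl, zero_le_one⟩ ρ hρ p.2 u ⟨by rwa [hp'], by
      rw [hp']; exact mem_of_mem_nhds hU⟩ hu
    rwa [zero_smul, add_zero, dist_zero_left, norm_smul, (hN.1 _ hu.1).2, mul_one,
      Real.norm_of_nonneg hρ.1] at this
  obtain ⟨m, hm, C, hC, hpair, hrad⟩ := exists_innerDist_le_of_end (o := a)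
    isRadialParametrization_id isClosed_closure hZM (isOpen_lt continuous_fst continuous_const)
    (fun p _ hp0 => hp0.trans_lt hr) hN hS hvert
  have hpolar : ∀ x ∈ X ∩ Metric.ball a (min m (min 1 r)), x = a ∨
      ∃ ρ ∈ Set.Icc (0 : ℝ) 1, ∃ u, ρ < m ∧ ‖u‖ = 1 ∧
        (id ρ, u) ∈ strictTransform (X ∩ Metric.ball a r) a ∧ x = a + ρ • u := by
    rintro x ⟨hxX, hxb⟩
    rw [Metric.mem_ball, dist_eq_norm] at hxb
    refine or_iff_not_imp_left.2 fun hne => ?_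
    have hne' : x - a ≠ 0 := sub_ne_zero.2 hne
    have hx : a + ‖x - a‖ • (‖x - a‖⁻¹ • (x - a)) = x := by
      rw [smul_smul, mul_inv_cancel₀ (norm_ne_zero_iff.2 hne'), one_smul, add_sub_cancel]
    refine ⟨‖x - a‖, ⟨norm_nonneg _, ?_⟩, ‖x - a‖⁻¹ • (x - a), hxb.trans_le (min_le_left _ _),
      norm_inv_norm_smul hne', subset_closure ⟨norm_pos_iff.2 hne', norm_inv_norm_smul hne', ?_⟩,
      hx.symm⟩
    · exact (hxb.trans_le ((min_le_right _ _).trans (min_le_left _ _))).le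
    · simp only [id]
      rw [hx]
      refine ⟨hxX, ?_⟩
      rw [Metric.mem_ball, dist_eq_norm]
      exact hxb.trans_le ((min_le_right _ _).trans (min_le_right _ _))
  refine ⟨C, hC, Metric.ball a (min m (min 1 r)),
    Metric.ball_mem_nhds _ (lt_min hm (lt_min one_pos hr)), fun x hx y hy => ?_⟩
  rcases hpolar x hx with rfl | ⟨ρ, hρ, u, hρm, hu, hxZ, rfl⟩
  · rcases hpolar y hy with rfl | ⟨ρ', hρ', u', hρm', hu', hyZ, rfl⟩
    · simp [innerDist_self hx.1]
    · refine (hrad ρ' hρ' u' hρm' hyZ).trans_eq ?_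
      rw [dist_self_add_right, norm_smul, hu', mul_one, Real.norm_of_nonneg hρ'.1]
  · rcases hpolar y hy with rfl | ⟨ρ', hρ', u', hρm', hu', hyZ, rfl⟩
    · rw [innerDist_comm]
      refine (hrad ρ hρ u hρm hxZ).trans_eq ?_
      rw [dist_self_add_left, norm_smul, hu, mul_one, Real.norm_of_nonneg hρ.1]
    · rw [dist_add_left]
      exact hpair ρ hρ ρ' hρ' u u' hρm hρm' hxZ hyZ

end ConicPoint

section Global

variable {E : Type*} [PseudoMetricSpace E] {X : Set E}

lemma innerDist_lt_top_of_isPreconnected (hconn : IsPreconnected X)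
    (hloc : ∀ a ∈ X, ∃ C : ℝ, 0 ≤ C ∧ ∃ U ∈ 𝓝 a, ∀ x ∈ X ∩ U, ∀ y ∈ X ∩ U,
      innerDist X x y ≤ ENNReal.ofReal (C * dist x y))
    {x y : E} (hx : x ∈ X) (hy : y ∈ X) : innerDist X x y < ⊤ := by
  refine hconn.induction₂ (fun x y => innerDist X x y < ⊤) ?_ ?_ ?_ hx hy
  · intro a ha
    obtain ⟨C, -, U, hU, h⟩ := hloc a ha
    filter_upwards [nhdsWithin_le_nhds hU, self_mem_nhdsWithin] with y hyU hyX
    exact (h a ⟨ha, mem_of_mem_nhds hU⟩ y ⟨hyX, hyU⟩).trans_lt ENNReal.ofReal_lt_top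
  · intro x y z _ _ _ hxy hyz
    exact (innerDist_triangle X x y z).trans_lt (ENNReal.add_lt_top.2 ⟨hxy, hyz⟩)
  · intro x y _ _ hxy
    rwa [innerDist_comm]

end Global

section GlobalMetric

variable {E : Type*} [MetricSpace E] {X : Set E}

lemma exists_innerDist_le_of_isCompact
    (hloc : ∀ a ∈ X, ∃ C : ℝ, 0 ≤ C ∧ ∃ U ∈ 𝓝 a, ∀ x ∈ X ∩ U, ∀ y ∈ X ∩ U,
      innerDist X x y ≤ ENNReal.ofReal (C * dist x y))
    (hfin : ∀ x ∈ X, ∀ y ∈ X, innerDist X x y < ⊤) {K : Set E} (hK : IsCompact K)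
    (hKX : K ⊆ X) :
    ∃ C : ℝ, 0 ≤ C ∧ ∀ x ∈ K, ∀ y ∈ K, innerDist X x y ≤ ENNReal.ofReal (C * dist x y) := by
  have hpair : ∀ ab ∈ K ×ˢ K, ∃ C : ℝ, ∀ᶠ xy : E × E in 𝓝 ab, xy.1 ∈ X → xy.2 ∈ X →
      innerDist X xy.1 xy.2 ≤ ENNReal.ofReal (C * dist xy.1 xy.2) := by
    rintro ⟨a, b⟩ ⟨ha, hb⟩
    have ha : a ∈ X := hKX ha
    have hb : b ∈ X := hKX hb
    obtain ⟨C, hC, U, hU, h⟩ := hloc a ha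
    by_cases hab : a = b
    · subst hab
      refine ⟨C, ?_⟩
      filter_upwards [prod_mem_nhds hU hU] with xy hxy hx hy
      exact h _ ⟨hx, hxy.1⟩ _ ⟨hy, hxy.2⟩
    · obtain ⟨C', hC', U', hU', h'⟩ := hloc b hb
      set D := (innerDist X a b).toReal with hD
      have hD' : innerDist X a b ≤ ENNReal.ofReal D :=
        (ENNReal.ofReal_toReal (hfin a ha b hb).ne).ge
      have hD0 : 0 ≤ D := ENNReal.toReal_nonneg
      have hd0 : 0 < dist a b := dist_pos.2 hab
      refine ⟨(C + D + C') / (dist a b / 2), ?_⟩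
      have hfar : ∀ᶠ xy : E × E in 𝓝 (a, b), dist a b / 2 < dist xy.1 xy.2 :=
        continuous_dist.continuousAt.eventually_const_lt (show dist a b / 2 < dist a b by linarith)
      filter_upwards [hfar, prod_mem_nhds (inter_mem hU (Metric.ball_mem_nhds a one_pos))
        (inter_mem hU' (Metric.ball_mem_nhds b one_pos))] with xy hxy hUb hx hy
      have e1 := (h xy.1 ⟨hx, hUb.1.1⟩ a ⟨ha, mem_of_mem_nhds hU⟩).trans
        (ENNReal.ofReal_le_ofReal (mul_le_of_le_one_right hC (Metric.mem_ball.1 hUb.1.2).le))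
      have e2 := (h' b ⟨hb, mem_of_mem_nhds hU'⟩ xy.2 ⟨hy, hUb.2.1⟩).trans
        (ENNReal.ofReal_le_ofReal (mul_le_of_le_one_right hC'
          (by rw [dist_comm]; exact (Metric.mem_ball.1 hUb.2.2).le)))
      refine (innerDist_le_ofReal_add (by positivity) hC'
        (innerDist_le_ofReal_add hC hD0 e1 hD') e2).trans (ENNReal.ofReal_le_ofReal ?_)
      rw [div_mul_eq_mul_div, le_div_iff₀ (half_pos hd0)]
      exact mul_le_mul_of_nonneg_left hxy.le (by positivity)
  obtain ⟨C, hC, h⟩ := (hK.prod hK).exists_eventually_nhdsSet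
    (fun C C' x hCC' h hx hy => (h hx hy).trans
      (ENNReal.ofReal_le_ofReal (mul_le_mul_of_nonneg_right hCC' dist_nonneg))) hpair
  exact ⟨C, hC, fun x hx y hy => h.self_of_nhdsSet (x, y) ⟨hx, hy⟩ (hKX hx) (hKX hy)⟩

lemma isLNE_of_innerDist_le {C : ℝ}
    (h : ∀ x ∈ X, ∀ y ∈ X, innerDist X x y ≤ ENNReal.ofReal (C * dist x y)) : IsLNE X := by
  refine ⟨Real.toNNReal (max C 1), by simp, fun x hx y hy => (h x hx y hy).trans ?_⟩
  rw [edist_dist, ← ENNReal.ofReal, ← ENNReal.ofReal_mul (by positivity)]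
  exact ENNReal.ofReal_le_ofReal (mul_le_mul_of_nonneg_right (le_max_left _ _) dist_nonneg)

end GlobalMetric

section Infinity

variable {E : Type*} [NormedAddCommGroup E] [InnerProductSpace ℝ E] [FiniteDimensional ℝ E]
  {X : Set E}

lemma exists_innerDist_le_at_infinity (hX : IsClosed X)
    (hfin : ∀ x ∈ X, ∀ y ∈ X, innerDist X x y < ⊤) {W : Set (ℝ × E)} (hW : IsOpen W)
    (hXW : {(0 : ℝ)} ×ˢ asymptoticSet X ⊆ W) (hN : IsPSubmanifold (closureAtInfinity X ∩ W))
    {o : E} (ho : o ∈ X) :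
    ∃ R C : ℝ, 0 < R ∧ 0 ≤ C ∧
      (∀ x ∈ X, ∀ y ∈ X, R < ‖x‖ → R < ‖y‖ →
        innerDist X x y ≤ ENNReal.ofReal (C * dist x y)) ∧
      ∀ x ∈ X, R < ‖x‖ → innerDist X o x ≤ ENNReal.ofReal (C * ‖x‖) := by
  have hZM : ∀ p ∈ closureAtInfinity X, 0 ≤ p.1 ∧ ‖p.2‖ = 1 :=
    closure_minimal (fun p hp => ⟨hp.1.le, hp.2.1⟩) isClosed_nonneg_prod_sphere
  have hZX : ∀ ρ ∈ Set.Ici (1 : ℝ), ∀ u, (ρ⁻¹, u) ∈ closureAtInfinity X ∩ W →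
      (0 : E) + ρ • u ∈ X := by
    intro ρ hρ u hu
    have hρ0 : ρ ≠ 0 := (zero_lt_one.trans_le hρ).ne'
    have hc : ContinuousAt (fun p : ℝ × E => p.1⁻¹ • p.2) (ρ⁻¹, u) :=
      (continuousAt_fst.inv₀ (inv_ne_zero hρ0)).smul continuousAt_snd
    have := mem_closure_image hc hu.1
    rw [inv_inv] at this
    rw [zero_add]
    exact closure_minimal (by rintro _ ⟨p, hp, rfl⟩; exact hp.2.2) hX this
  have hZW : ∀ p ∈ closureAtInfinity X, p.1 ≤ 0 → p ∈ W := by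
    intro p hp hp0
    have hp0 : p.1 = 0 := le_antisymm hp0 (hZM p hp).1
    refine hXW ⟨hp0, ?_⟩
    rwa [asymptoticSet, Set.mem_ofPred_eq, ← hp0]
  have hend : ∀ p ∈ closureAtInfinity X ∩ W, p.1 = 0 → ∃ C : ℝ, ∃ U ∈ 𝓝 p,
      ∀ ρ ∈ Set.Ici (1 : ℝ), ∀ u, (ρ⁻¹, u) ∈ closureAtInfinity X ∩ W ∩ U →
        innerDist X o (0 + ρ • u) ≤ ENNReal.ofReal (C * ρ) := by
    intro p hp hp0
    obtain ⟨C, hC, U, hU, h⟩ := hN.exists_innerDist_smul_le isRadialParametrization_inv hp hp0 hZX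
    by_cases hne : ∃ ρ₀ ∈ Set.Ici (1 : ℝ), ∃ u₀, (ρ₀⁻¹, u₀) ∈ closureAtInfinity X ∩ W ∩ U
    · obtain ⟨ρ₀, hρ₀, u₀, hu₀⟩ := hne
      have hmem := hZX ρ₀ hρ₀ u₀ hu₀.1
      set D := (innerDist X o (0 + ρ₀ • u₀)).toReal with hD
      have hD' : innerDist X o (0 + ρ₀ • u₀) ≤ ENNReal.ofReal D :=
        (ENNReal.ofReal_toReal (hfin o ho _ hmem).ne).ge
      have hD0 : 0 ≤ D := ENNReal.toReal_nonneg
      refine ⟨D + C * ρ₀ + C, U, hU, fun ρ hρ u hu => ?_⟩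
      have hρ1 : 1 ≤ ρ := hρ
      have hρ1' : 1 ≤ ρ₀ := hρ₀
      refine (innerDist_le_ofReal_add hD0 (by positivity) hD'
        (h ρ₀ hρ₀ ρ hρ u₀ u hu₀ hu)).trans (ENNReal.ofReal_le_ofReal ?_)
      have hd : dist (ρ₀ • u₀) (ρ • u) ≤ ρ₀ + ρ := by
        refine (dist_le_norm_add_norm _ _).trans_eq ?_
        rw [norm_smul, norm_smul, (hN.1 _ hu₀.1).2, (hN.1 _ hu.1).2, mul_one, mul_one,
          Real.norm_of_nonneg (by linarith), Real.norm_of_nonneg (by linarith)]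
      have h1 := mul_le_mul_of_nonneg_left hd hC
      have h2 : D + C * ρ₀ ≤ (D + C * ρ₀) * ρ := le_mul_of_one_le_right (by positivity) hρ1
      linarith
    · exact ⟨0, U, hU, fun ρ hρ u hu => (hne ⟨ρ, hρ, u, hu⟩).elim⟩
  obtain ⟨m, hm, C, hC, hpair, hrad⟩ := exists_innerDist_le_of_end (o := o)
    isRadialParametrization_inv isClosed_closure hZM hW hZW hN hZX hend
  have hpolar : ∀ x ∈ X, max 1 m⁻¹ < ‖x‖ → ‖x‖ ∈ Set.Ici (1 : ℝ) ∧ ‖x‖⁻¹ < m ∧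
      (‖x‖⁻¹, ‖x‖⁻¹ • x) ∈ closureAtInfinity X ∧ (0 : E) + ‖x‖ • (‖x‖⁻¹ • x) = x := by
    intro x hxX hx
    have h1 : 1 < ‖x‖ := (le_max_left _ _).trans_lt hx
    have hx0 : 0 < ‖x‖ := zero_lt_one.trans h1
    have hx' : ‖x‖ • (‖x‖⁻¹ • x) = x := by
      rw [smul_smul, mul_inv_cancel₀ hx0.ne', one_smul]
    refine ⟨h1.le, inv_lt_of_inv_lt₀ hm ((le_max_right _ _).trans_lt hx),
      subset_closure ⟨inv_pos.2 hx0, norm_inv_norm_smul (norm_pos_iff.1 hx0), ?_⟩, ?_⟩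
    · simpa only [inv_inv, hx'] using hxX
    · rw [hx', zero_add]
  refine ⟨max 1 m⁻¹, C, lt_max_of_lt_left one_pos, hC, ?_, ?_⟩
  · intro x hx y hy hxR hyR
    obtain ⟨h1, h2, h3, h4⟩ := hpolar x hx hxR
    obtain ⟨k1, k2, k3, k4⟩ := hpolar y hy hyR
    have := hpair _ h1 _ k1 _ _ h2 k2 h3 k3
    rw [h4, k4] at this
    rw [zero_add] at h4 k4
    rwa [h4, k4] at this
  · intro x hx hxR
    obtain ⟨h1, h2, h3, h4⟩ := hpolar x hx hxR
    have := hrad _ h1 _ h2 h3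
    rwa [h4] at this

/-- Connected conic singular sub-manifolds are Lipschitz normally embedded. -/
lemma IsConicSingularSubmanifold.isLNE (hX : IsConicSingularSubmanifold X)
    (hconn : IsConnected X) : IsLNE X := by
  have : ProperSpace E := FiniteDimensional.proper ℝ E
  have hloc : ∀ a ∈ X, ∃ C : ℝ, 0 ≤ C ∧ ∃ U ∈ 𝓝 a, ∀ x ∈ X ∩ U, ∀ y ∈ X ∩ U,
      innerDist X x y ≤ ENNReal.ofReal (C * dist x y) := by
    intro a ha
    by_cases hs : IsSmoothPoint X a
    · exact hs.exists_innerDist_le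
    · exact (hX.conic_of_singular a ⟨ha, hs⟩).exists_innerDist_le hX.isClosed
  have hfin : ∀ x ∈ X, ∀ y ∈ X, innerDist X x y < ⊤ := fun x hx y hy =>
    innerDist_lt_top_of_isPreconnected hconn.isPreconnected hloc hx hy
  rcases hX.conic_at_infinity with hb | ⟨-, W, hW, hXW, hN⟩
  · obtain ⟨C, -, h⟩ := exists_innerDist_le_of_isCompact hloc hfin
      (Metric.isCompact_of_isClosed_isBounded hX.isClosed hb) subset_rfl
    exact isLNE_of_innerDist_le h
  · obtain ⟨o, ho⟩ := hconn.nonempty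
    obtain ⟨R₁, C₁, hR₁, hC₁, hpair, hrad⟩ :=
      exists_innerDist_le_at_infinity hX.isClosed hfin hW hXW hN ho
    set R := max R₁ ‖o‖ with hR
    have hR0 : 0 < R := lt_max_of_lt_left hR₁
    have hRR : R₁ ≤ R := le_max_left _ _
    obtain ⟨C₂, hC₂, hcomp⟩ := exists_innerDist_le_of_isCompact hloc hfin
      ((isCompact_closedBall (0 : E) (2 * R)).inter_left hX.isClosed) Set.inter_subset_left
    have hoK : o ∈ X ∩ Metric.closedBall (0 : E) (2 * R) :=
      ⟨ho, by rw [mem_closedBall_zero_iff]; linarith [le_max_right R₁ ‖o‖]⟩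
    have hmixed : ∀ x ∈ X, ∀ y ∈ X, ‖x‖ ≤ R → 2 * R < ‖y‖ →
        innerDist X x y ≤ ENNReal.ofReal ((2 * C₂ + 2 * C₁) * dist x y) := by
      intro x hx y hy hxR hyR
      have hxo : dist x o ≤ 2 * R := by
        refine (dist_le_norm_add_norm x o).trans ?_
        linarith [le_max_right R₁ ‖o‖]
      have hxy : ‖y‖ ≤ 2 * dist x y := by
        have := norm_sub_norm_le y x
        rw [← dist_eq_norm, dist_comm] at this
        linarith
      refine (innerDist_le_ofReal_add (by positivity) (by positivity)
        (hcomp x ⟨hx, by rw [mem_closedBall_zero_iff]; linarith⟩ o hoK)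
        (hrad y hy (by linarith))).trans (ENNReal.ofReal_le_ofReal ?_)
      have h1 := mul_le_mul_of_nonneg_left (hxo.trans (hyR.le.trans hxy)) hC₂
      have h2 := mul_le_mul_of_nonneg_left hxy hC₁
      linarith
    refine isLNE_of_innerDist_le (C := 2 * C₂ + 2 * C₁) fun x hx y hy => ?_
    have hd : 0 ≤ dist x y := dist_nonneg
    by_cases hxR : ‖x‖ ≤ R
    · by_cases hyR : ‖y‖ ≤ 2 * R
      · refine (hcomp x ⟨hx, by rw [mem_closedBall_zero_iff]; linarith⟩ y
          ⟨hy, by rwa [mem_closedBall_zero_iff]⟩).trans (ENNReal.ofReal_le_ofReal ?_)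
        nlinarith
      · exact hmixed x hx y hy hxR (not_le.1 hyR)
    · by_cases hyR : ‖y‖ ≤ R
      · by_cases hxR' : ‖x‖ ≤ 2 * R
        · refine (hcomp x ⟨hx, by rwa [mem_closedBall_zero_iff]⟩ y
            ⟨hy, by rw [mem_closedBall_zero_iff]; linarith⟩).trans (ENNReal.ofReal_le_ofReal ?_)
          nlinarith
        · rw [innerDist_comm, dist_comm]
          exact hmixed y hy x hx hyR (not_le.1 hxR')
      · refine (hpair x hx y hy (by linarith) (by linarith)).trans (ENNReal.ofReal_le_ofReal ?_)
        nlinarith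

end Infinity

end ConicLNE

theorem theorem3p9 (n : ℕ) (X : Set (EuclideanSpace ℝ (Fin n)))
    (hX : ConicLNE.IsConicSingularSubmanifold X) (hconn : IsConnected X) :
    ConicLNE.IsLNE X :=
  hX.isLNE hconn
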